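/- **Setting.** All logarithms are to base $2$. Let $H(u)=-u\log u-(1-u)\log(1-u)$ and $D_{KL}(u\|p)=u\log\frac{u}{p}+(1-u)\log\frac{1-u}{1-p}$. Let $m\ge 2$ and consider the memoryless $m$-ary symmetric channel with $\Pr(r|c)=p$ if $r=c$ and $\Pr(r|c)=\frac{1-p}{m-1}$ if $r\ne c$, where $\frac{1-p}{m-1}<p<1$. When a word $c\in\mathbb F_m^n$ is transmitted, the error pattern $X^n\in\{0,1\}^n$ has $X_i=1$ if the hard decision (most likely symbol, for uniformly distributed symbols) at position $i$ equals $c_i$, and $X_i=0$ otherwise. In mBM-1 (multiple errors-and-erasures decoding) one attempt is made for each erasure pattern $\hat x^n\in\{0,1\}^n$ in a set $\mathcal B_n$ ($\hat x_i=0$ means that position $i$ is erased). The distortion is $d(x^n,\hat x^n)=\sum_i\delta(x_i,\hat x_i)$ with $\delta(0,0)=\delta(1,0)=1$, $\delta(0,1)=2$, $\delta(1,1)=0$. Let $N\ge 1$, $0<D<N$ and $0<R\le N\,H(1-\frac DN)$, and put $p_e(\mathcal B_n)=\Pr\big(\min_{\hat x^n\in\mathcal B_n}d(X^n,\hat x^n)>n\tfrac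 DN\big)$. A number $F$ is an achievable rate-distortion exponent (per $N$ letters, with $2^R$ attempts per $N$ letters) if there are sets $\mathcal B_n$ with $|\mathcal B_n|\le 2^{nR/N}$ such that for every $\varepsilon>0$, $p_e(\mathcal B_n)\le 2^{-n(F/N-\varepsilon)}$ for all large $n$. **Theorem.** For mBM-1 over this channel: 1. for every transmitted word the components of the error pattern are i.i.d. with $\Pr(X_i=1)=p$; 2. the map $h(u)=H(u)-H(u+\frac DN-1)$ is a bijection from $[1-\frac DN,\,1-\frac D{2N})$ onto $(0,\,H(1-\frac DN)]$, so that $h^{-1}$ is well defined there; 3. if $h^{-1}(\frac RN)\le p$, then the maximum achievable rate-distortion exponent is $$F=N\,D_{KL}\Big(h^{-1}\big(\tfrac RN\big)\,\Big\|\,p\Big),$$ and $\lim_{n\to\infty}-\frac1n\log\min_{\mathcal B_n:\,|\mathcal B_n|\le 2^{nR/N}}p_e(\mathcal B_n)=\frac FN$. -/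

import Mathlib

open Filter Topology

noncomputable section

namespace MultipleDecoding

/-- Binary entropy function, logarithms to base `2`. -/
def H (u : ℝ) : ℝ := -u * Real.logb 2 u - (1 - u) * Real.logb 2 (1 - u)

/-- Binary Kullback-Leibler divergence `D_KL(u‖p)`, logarithms to base `2`. -/
def DKL (u p : ℝ) : ℝ :=
  u * Real.logb 2 (u / p) + (1 - u) * Real.logb 2 ((1 - u) / (1 - p))

/-- `h(u) = H(u) - H(u + D - 1)`, for a per-letter distortion `D`. -/
def h (D u : ℝ) : ℝ := H u - H (u + D - 1)

/-- The inverse of `h` on the interval `[1 - D, 1 - D/2)`. -/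
def hInv (D r : ℝ) : ℝ := Function.invFunOn (h D) (Set.Ico (1 - D) (1 - D / 2)) r

section Channel

variable {𝔽 : Type*} [Fintype 𝔽] [DecidableEq 𝔽]

/-- Transition probability `Pr(r | c)` of the `m`-ary symmetric channel, `m = |𝔽|`. -/
def channel (p : ℝ) (r c : 𝔽) : ℝ :=
  if r = c then p else (1 - p) / ((Fintype.card 𝔽 : ℝ) - 1)

/-- A posteriori probability `Pr(c | r)` of a uniformly distributed transmitted symbol. -/
def posterior (p : ℝ) (c r : 𝔽) : ℝ := channel p r c / ∑ b : 𝔽, channel p r b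

/-- `φ` maps each received symbol to a most likely transmitted symbol. -/
def IsHardDecision (p : ℝ) (φ : 𝔽 → 𝔽) : Prop :=
  ∀ r a : 𝔽, posterior p a r ≤ posterior p (φ r) r

/-- The error pattern: the letter is `1` where the hard decision is correct, `0` where it is wrong. -/
def errorPattern (φ : 𝔽 → 𝔽) {n : ℕ} (c r : Fin n → 𝔽) : Fin n → Fin 2 :=
  fun i => if φ (r i) = c i then 1 else 0

/-- Probability that the error pattern `Xⁿ` equals `x` when the word `c` is sent over the
memoryless symmetric channel. -/
def patternProb (p : ℝ) (φ : 𝔽 → 𝔽) {n : ℕ} (c : Fin n → 𝔽) (x : Fin n → Fin 2) : ℝ :=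
  ∑ r : Fin n → 𝔽 with errorPattern φ c r = x, ∏ i, channel p (r i) (c i)

end Channel

/-- Letter-by-letter distortion of errors-and-erasures decoding (first argument: error letter,
second argument: erasure letter, where `0` means erased): an erasure costs `1`, an unerased error
costs `2`, an unerased correct symbol costs `0`. -/
def δ (j k : Fin 2) : ℝ := (![![1, 2], ![1, 0]] : Fin 2 → Fin 2 → ℝ) j k

/-- Distortion between an error pattern and an erasure pattern. -/
def distortion {n : ℕ} (x xhat : Fin n → Fin 2) : ℝ := ∑ i, δ (x i) (xhat i)

/-- Sets of at most `2 ^ (n r)` erasure patterns of length `n`: one decoding attempt is made for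
each erasure pattern in the set. -/
def Codebook (n : ℕ) (r : ℝ) : Type :=
  {B : Finset (Fin n → Fin 2) // (B.card : ℝ) ≤ (2 : ℝ) ^ ((n : ℝ) * r)}

section Exponent

variable {𝔽 : Type*} [Fintype 𝔽] [DecidableEq 𝔽]

open Classical in
/-- `p_e = Pr (min_{x̂ ∈ B} d(Xⁿ, x̂) > T)`, the probability that no attempt in `B` brings the
distortion down to the threshold `T`, when the word `c` is transmitted. -/
def errorProb (p : ℝ) (φ : 𝔽 → 𝔽) {n : ℕ} (c : Fin n → 𝔽) (T : ℝ)
    (B : Finset (Fin n → Fin 2)) : ℝ :=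
  ∑ x : Fin n → Fin 2 with ∀ xhat ∈ B, T < distortion x xhat, patternProb p φ c x

/-- The smallest `p_e` over all sets of at most `2 ^ (n r)` erasure patterns, at distortion
threshold `n d`. -/
def minErrorProb (p : ℝ) (φ : 𝔽 → 𝔽) {n : ℕ} (c : Fin n → 𝔽) (r d : ℝ) : ℝ :=
  ⨅ B : Codebook n r, errorProb p φ c ((n : ℝ) * d) B.val

/-- `F` is an achievable exponent (unnormalized, i.e. per `N` letters) at total rate `R` and total
distortion `D` per `N` letters: some sequence of sets of at most `2 ^ (n R / N)` erasure patterns of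
length `n` satisfies, for every `ε > 0`, `p_e ≤ 2 ^ (-n (F / N - ε))` at threshold `n D / N` for all
large `n`. The words `c n` are the transmitted ones. -/
def IsAchievableExponent (p : ℝ) (φ : 𝔽 → 𝔽) (c : (n : ℕ) → Fin n → 𝔽) (N : ℕ) (R D F : ℝ) :
    Prop :=
  ∃ B : (n : ℕ) → Codebook n (R / N), ∀ ε : ℝ, 0 < ε → ∀ᶠ n : ℕ in atTop,
    errorProb p φ (c n) ((n : ℝ) * (D / N)) (B n).val ≤ (2 : ℝ) ^ (-(n : ℝ) * (F / N - ε))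

end Exponent

end MultipleDecoding

end

/-! Hard decisions are the received symbols themselves, so the error pattern is i.i.d. Bernoulli(p).
Write d = D/N, r = R/N. If A and C are the supports of the error and erasure patterns, the
distortion is |A ∆ C| + n - |A| (`distortion_eq`). An error pattern of weight nu is thus decoded iff
some centre lies within Hamming distance n(u + d - 1) of it. Covering the layer of weight nu by such
balls costs rate H(u) - H(u + d - 1) = h(u), and below weight n(1 - d) no ball exists at any rate.
As h is decreasing, the budget r pays for all layers above u = h⁻¹(r) and none below; for u ≤ p the
failure event is a binomial lower tail, of exponent D_KL(u‖p).

Achievability (`eventually_minErrorProb_le`): a greedy choice of centres covers one layer k with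
polynomial loss. This already covers every higher layer, because one more element of A increases
both the distance and the allowed radius by at most, respectively exactly, one
(`exists_cover_upper_layers`). The rest is Chernoff's bound, `sum_lower_tail_le`.

Converse (`eventually_le_minErrorProb`): for v slightly below u the balls are too few or too small
to cover half of the layer of weight nv, and the patterns of one layer are equally likely.
Stirling's formula gives all the rates, and continuity of D_KL lets v tend to u from either side. -/

noncomputable section

namespace MultipleDecoding

/-! ### Hard decisions and the law of the error pattern. -/

section SymmetricChannel

variable {𝔽 : Type*} [Fintype 𝔽]

theorem one_lt_card_cast [Nontrivial 𝔽] : (1 : ℝ) < Fintype.card 𝔽 := by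
  exact_mod_cast Fintype.one_lt_card

theorem correct_prob_pos [Nontrivial 𝔽] {p : ℝ}
    (hp : (1 - p) / ((Fintype.card 𝔽 : ℝ) - 1) < p) (hp1 : p < 1) : 0 < p := by
  have h1 := one_lt_card_cast (𝔽 := 𝔽)
  exact (div_pos (by linarith) (by linarith)).trans hp

variable [DecidableEq 𝔽]

theorem channel_self (p : ℝ) (c : 𝔽) : channel p c c = p := by simp [channel]

theorem sum_channel_ne [Nontrivial 𝔽] (p : ℝ) (c : 𝔽) :
    ∑ s with s ≠ c, channel p s c = 1 - p := by
  have h1 := one_lt_card_cast (𝔽 := 𝔽)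
  rw [Finset.sum_congr rfl (g := fun _ => (1 - p) / ((Fintype.card 𝔽 : ℝ) - 1))]
  · rw [Finset.sum_const, Finset.filter_ne', Finset.card_erase_of_mem (Finset.mem_univ _),
      Finset.card_univ, nsmul_eq_mul, Nat.cast_sub Fintype.card_pos, Nat.cast_one]
    field_simp [(by linarith : (Fintype.card 𝔽 : ℝ) - 1 ≠ 0)]
  · intro s hs
    simp only [Finset.mem_filter, Finset.mem_univ, true_and] at hs
    simp [channel, hs]

/-- The channel matrix is symmetric, so the normaliser of the posterior is 1 and the posterior is
the transition probability, whose maximum p is attained only at the received symbol. -/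
theorem IsHardDecision.eq_self [Nontrivial 𝔽] {p : ℝ} {φ : 𝔽 → 𝔽} (hφ : IsHardDecision p φ)
    (hp : (1 - p) / ((Fintype.card 𝔽 : ℝ) - 1) < p) (s : 𝔽) : φ s = s := by
  have hsum : ∑ b : 𝔽, channel p s b = 1 := by
    have h0 : ∑ b : 𝔽, channel p s b = ∑ b : 𝔽, channel p b s := by
      refine Finset.sum_congr rfl fun b _ => ?_
      simp [channel, eq_comm]
    rw [h0, ← Finset.sum_filter_add_sum_filter_not Finset.univ (fun b => b = s),
      sum_channel_ne, Finset.filter_eq' , if_pos (Finset.mem_univ _), Finset.sum_singleton,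
      channel_self]
    ring
  have h1 := hφ s s
  simp only [posterior, hsum, div_one, channel_self] at h1
  by_contra hne
  rw [channel, if_neg (fun h => hne h.symm)] at h1
  linarith

/-- The letters of the error pattern are independent, and equal to `1` with probability `p`. -/
theorem patternProb_eq_prod [Nontrivial 𝔽] {p : ℝ} {φ : 𝔽 → 𝔽} (hφ : IsHardDecision p φ)
    (hp : (1 - p) / ((Fintype.card 𝔽 : ℝ) - 1) < p) {n : ℕ} (w : Fin n → 𝔽) (x : Fin n → Fin 2) :
    patternProb p φ w x = ∏ i, if x i = 1 then p else 1 - p := by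
  -- Since the decision is the identity, the event is a product of conditions on single letters, and
  -- the sum of products factors.
  have hfilter : (Finset.univ.filter fun r : Fin n → 𝔽 => errorPattern φ w r = x) =
      Fintype.piFinset fun i => Finset.univ.filter fun s => (if s = w i then 1 else 0) = x i := by
    ext r
    simp [errorPattern, hφ.eq_self hp, funext_iff]
  rw [patternProb, hfilter, ← Finset.prod_univ_sum (f := fun i s => channel p s (w i))]
  refine Finset.prod_congr rfl fun i _ => ?_
  rcases (by omega : x i = 0 ∨ x i = 1) with hx | hx
  · rw [hx, if_neg (by decide), ← sum_channel_ne p (w i)]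
    refine Finset.sum_congr (Finset.filter_congr fun s _ => ?_) fun _ _ => rfl
    by_cases hs : s = w i <;> simp [hs]
  · rw [hx, if_pos rfl]
    have : (Finset.univ.filter fun s => (if s = w i then (1 : Fin 2) else 0) = 1) = {w i} := by
      ext s
      by_cases hs : s = w i <;> simp [hs]
    rw [this, Finset.sum_singleton, channel_self]

end SymmetricChannel

/-! ### Entropy, divergence and the function h. -/

section Entropy

theorem H_eq_binEntropy (u : ℝ) : H u = Real.binEntropy u / Real.log 2 := by
  simp only [H, Real.binEntropy, Real.logb, Real.log_inv]
  ring

theorem H_eq_binEntropy_mul (u : ℝ) : H u * Real.log 2 = Real.binEntropy u := by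
  have : Real.log 2 ≠ 0 := (Real.log_pos one_lt_two).ne'
  rw [H_eq_binEntropy, div_mul_cancel₀ _ this]

theorem continuous_H : Continuous H := by
  have : H = fun u => Real.binEntropy u / Real.log 2 := funext H_eq_binEntropy
  rw [this]
  exact Real.binEntropy_continuous.div_const _

theorem continuous_h (d : ℝ) : Continuous (h d) :=
  continuous_H.sub (continuous_H.comp (by fun_prop))

/-- The derivative is H'(u) - H'(u + d - 1), negative because H' is strictly decreasing and d < 1.
-/
theorem strictAntiOn_h {d : ℝ} (hd1 : d < 1) :
    StrictAntiOn (h d) (Set.Icc (1 - d) (1 - d / 2)) := by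
  refine strictAntiOn_of_deriv_neg (convex_Icc _ _) (continuous_h d).continuousOn fun u hu => ?_
  rw [interior_Icc] at hu
  obtain ⟨h1, h2⟩ := hu
  have hl : 0 < Real.log 2 := Real.log_pos one_lt_two
  have hHu : ∀ v : ℝ, v ≠ 0 → v ≠ 1 →
      HasDerivAt H ((Real.log (1 - v) - Real.log v) / Real.log 2) v := by
    intro v hv hv'
    have : H = fun u => Real.binEntropy u / Real.log 2 := funext H_eq_binEntropy
    rw [this]
    exact (Real.hasDerivAt_binEntropy hv hv').div_const _
  have hcomp := HasDerivAt.comp (h := fun v : ℝ => v + d - 1) u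
    (hHu (u + d - 1) (by linarith) (by linarith)) (((hasDerivAt_id u).add_const d).sub_const 1)
  have hder := (hHu u (by linarith) (by linarith)).sub hcomp
  have hh : h d = H - H ∘ fun v => v + d - 1 := rfl
  rw [hh, hder.deriv, mul_one, ← sub_div]
  refine div_neg_of_neg_of_pos ?_ hl
  have e1 : Real.log (1 - u) < Real.log (1 - (u + d - 1)) :=
    Real.log_lt_log (by linarith) (by linarith)
  have e2 : Real.log (u + d - 1) < Real.log u := Real.log_lt_log (by linarith) (by linarith)
  linarith

theorem h_left (d : ℝ) : h d (1 - d) = H (1 - d) := by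
  simp [h, H]

/-- At this endpoint the two arguments of H are 1 - d/2 and d/2, exchanged by the symmetry of H. -/
theorem h_right (d : ℝ) : h d (1 - d / 2) = 0 := by
  have : 1 - d / 2 + d - 1 = d / 2 := by ring
  simp only [h, H, this]
  ring_nf

theorem bijOn_h {d : ℝ} (hd0 : 0 < d) (hd1 : d < 1) :
    Set.BijOn (h d) (Set.Ico (1 - d) (1 - d / 2)) (Set.Ioc 0 (H (1 - d))) := by
  have hanti := strictAntiOn_h hd1
  have hle : 1 - d ≤ 1 - d / 2 := by linarith
  refine ⟨fun u hu => ⟨?_, ?_⟩, hanti.injOn.mono Set.Ico_subset_Icc_self, fun y hy => ?_⟩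
  · rw [← h_right d]
    exact hanti ⟨hu.1, hu.2.le⟩ ⟨hle, le_rfl⟩ hu.2
  · rw [← h_left d]
    exact hanti.antitoneOn ⟨le_rfl, hle⟩ ⟨hu.1, hu.2.le⟩ hu.1
  · have hivt := intermediate_value_Icc' hle (continuous_h d).continuousOn
    rw [h_left, h_right] at hivt
    obtain ⟨u, hu, rfl⟩ := hivt ⟨hy.1.le, hy.2⟩
    refine ⟨u, ⟨hu.1, lt_of_le_of_ne hu.2 ?_⟩, rfl⟩
    rintro rfl
    exact hy.1.ne' (h_right d)

theorem DKL_mul_log {u p : ℝ} (hu0 : 0 < u) (hu1 : u < 1) (hp0 : 0 < p) (hp1 : p < 1) :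
    DKL u p * Real.log 2 =
      u * (Real.log u - Real.log p) + (1 - u) * (Real.log (1 - u) - Real.log (1 - p)) := by
  have : Real.log 2 ≠ 0 := (Real.log_pos one_lt_two).ne'
  rw [DKL, Real.logb, Real.logb, Real.log_div hu0.ne' hp0.ne',
    Real.log_div (by linarith) (by linarith)]
  field_simp

theorem continuousAt_DKL {u p : ℝ} (hu0 : 0 < u) (hu1 : u < 1) (hp0 : 0 < p) (hp1 : p < 1) :
    ContinuousAt (fun v => DKL v p) u := by
  have h1 : u / p ≠ 0 := (div_pos hu0 hp0).ne'
  have h2 : (1 - u) / (1 - p) ≠ 0 := (div_pos (by linarith) (by linarith)).ne'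
  unfold DKL Real.logb
  refine ContinuousAt.add (ContinuousAt.mul continuousAt_id ?_) (ContinuousAt.mul (by fun_prop) ?_)
  · exact (ContinuousAt.log (continuousAt_id.div_const _) h1).div_const _
  · exact (ContinuousAt.log (ContinuousAt.div_const (by fun_prop) _) h2).div_const _

end Entropy

/-! ### Binary words as subsets. -/

section Supports

open scoped symmDiff

/-- The set of positions at which a binary word has the letter `1`. -/
def supportEquiv (n : ℕ) : (Fin n → Fin 2) ≃ Finset (Fin n) where
  toFun x := Finset.univ.filter fun i => x i = 1
  invFun A := fun i => if i ∈ A then 1 else 0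
  left_inv x := by
    funext i
    rcases (by omega : x i = 0 ∨ x i = 1) with hx | hx <;> simp [hx]
  right_inv A := by
    ext i
    simp

theorem mem_supportEquiv {n : ℕ} (x : Fin n → Fin 2) (i : Fin n) :
    i ∈ supportEquiv n x ↔ x i = 1 := by
  simp [supportEquiv]

/-- The distortion is the Hamming distance plus the number of wrong hard decisions. -/
theorem distortion_eq {n : ℕ} (x y : Fin n → Fin 2) :
    distortion x y =
      ((supportEquiv n x ∆ supportEquiv n y).card : ℝ) + (n - (supportEquiv n x).card) := by
  have hn : (n : ℝ) = ∑ _i : Fin n, (1 : ℝ) := by simp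
  have hcard : ∀ A : Finset (Fin n), (A.card : ℝ) = ∑ i, if i ∈ A then (1 : ℝ) else 0 := by
    intro A
    rw [Finset.sum_ite_mem, Finset.univ_inter]
    simp
  rw [distortion, hcard, hcard, hn, ← Finset.sum_sub_distrib, ← Finset.sum_add_distrib]
  refine Finset.sum_congr rfl fun i _ => ?_
  simp only [Finset.mem_symmDiff, mem_supportEquiv]
  rcases (by omega : x i = 0 ∨ x i = 1) with hx | hx <;>
    rcases (by omega : y i = 0 ∨ y i = 1) with hy | hy <;> norm_num [hx, hy, δ]

theorem prod_letterProb {n : ℕ} (p : ℝ) (x : Fin n → Fin 2) :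
    (∏ i, if x i = 1 then p else 1 - p) =
      p ^ (supportEquiv n x).card * (1 - p) ^ (n - (supportEquiv n x).card) := by
  rw [Finset.prod_ite, Finset.prod_const, Finset.prod_const, Finset.filter_not,
    Finset.card_sdiff_of_subset (Finset.filter_subset _ _), Finset.card_univ, Fintype.card_fin]
  rfl

end Supports

/-! ### Binomial tails and volumes of Hamming balls. -/

section Tail

/-- Change of measure from p to u: the logarithms of the two sides differ by (nu - k) times the gap
between the log-odds of p and u, and both factors are nonnegative. -/
theorem pow_mul_pow_le_exp_mul {n k : ℕ} (hk : k ≤ n) {u p : ℝ} (hu0 : 0 < u) (hup : u ≤ p)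
    (hp1 : p < 1) (hku : (k : ℝ) ≤ n * u) :
    p ^ k * (1 - p) ^ (n - k) ≤ Real.exp (-(n * (DKL u p * Real.log 2))) *
      (u ^ k * (1 - u) ^ (n - k)) := by
  have hp0 : 0 < p := hu0.trans_le hup
  have hq : 0 < 1 - p := by linarith
  have hv : 0 < 1 - u := by linarith
  rw [← Real.log_le_log_iff (by positivity) (by positivity), Real.log_mul (by positivity)
    (by positivity), Real.log_mul (by positivity) (by positivity), Real.log_mul (by positivity)
    (by positivity), Real.log_exp, Real.log_pow, Real.log_pow, Real.log_pow, Real.log_pow,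
    DKL_mul_log hu0 (by linarith) hp0 hp1, Nat.cast_sub hk]
  have h1 : Real.log u ≤ Real.log p := Real.log_le_log hu0 hup
  have h2 : Real.log (1 - p) ≤ Real.log (1 - u) := Real.log_le_log hq (by linarith)
  nlinarith [mul_nonneg (sub_nonneg.2 hku) (by linarith :
    0 ≤ (Real.log p - Real.log u) + (Real.log (1 - u) - Real.log (1 - p)))]

/-- Chernoff's bound for the lower tail of a binomial distribution. -/
theorem sum_lower_tail_le (n : ℕ) {u p : ℝ} (hu0 : 0 < u) (hup : u ≤ p) (hp1 : p < 1) :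
    ∑ A : Finset (Fin n) with (A.card : ℝ) ≤ n * u, p ^ A.card * (1 - p) ^ (n - A.card) ≤
      Real.exp (-(n * (DKL u p * Real.log 2))) := by
  have hv : 0 < 1 - u := by linarith
  calc _ ≤ ∑ A : Finset (Fin n) with (A.card : ℝ) ≤ n * u,
        Real.exp (-(n * (DKL u p * Real.log 2))) * (u ^ A.card * (1 - u) ^ (n - A.card)) := by
        refine Finset.sum_le_sum fun A hA => ?_
        exact pow_mul_pow_le_exp_mul (by simpa using Finset.card_le_univ A) hu0 hup hp1
          (Finset.mem_filter.1 hA).2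
    _ ≤ ∑ A : Finset (Fin n),
        Real.exp (-(n * (DKL u p * Real.log 2))) * (u ^ A.card * (1 - u) ^ (n - A.card)) :=
        Finset.sum_le_sum_of_subset_of_nonneg (Finset.filter_subset _ _) fun A _ _ => by positivity
    _ = _ := by
        rw [← Finset.mul_sum, Fin.sum_pow_mul_eq_add_pow]
        simp

/-- This is the tail bound at p = 1/2, where every subset has the same mass 2⁻ⁿ, so that a
probability is a cardinality. -/
theorem card_filter_card_le_exp (n : ℕ) {u : ℝ} (hu0 : 0 < u) (hu : u ≤ 1 / 2) :
    ((Finset.univ.filter fun A : Finset (Fin n) => (A.card : ℝ) ≤ n * u).card : ℝ) ≤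
      Real.exp (n * Real.binEntropy u) := by
  have htail := sum_lower_tail_le n hu0 hu (by norm_num)
  have hterm : ∀ A : Finset (Fin n), (1 / 2 : ℝ) ^ A.card * (1 - 1 / 2) ^ (n - A.card) =
      Real.exp (-(n * Real.log 2)) := by
    intro A
    have hA : A.card ≤ n := by simpa using Finset.card_le_univ A
    rw [show (1 : ℝ) - 1 / 2 = 1 / 2 by norm_num, ← pow_add, Nat.add_sub_cancel' hA, ← mul_neg,
      Real.exp_nat_mul, ← Real.log_inv, Real.exp_log (by norm_num)]
    norm_num
  have hlog : Real.log (1 / 2) = -Real.log 2 := by rw [one_div, Real.log_inv]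
  have hKL : DKL u (1 / 2) * Real.log 2 = Real.log 2 - Real.binEntropy u := by
    rw [DKL_mul_log hu0 (by linarith) (by norm_num) (by norm_num),
      show (1 : ℝ) - 1 / 2 = 1 / 2 by norm_num, hlog, Real.binEntropy, Real.log_inv, Real.log_inv]
    ring
  rw [Finset.sum_congr rfl fun A _ => hterm A, Finset.sum_const, nsmul_eq_mul, hKL] at htail
  have := mul_le_mul_of_nonneg_right htail (Real.exp_pos (n * Real.log 2)).le
  rw [mul_assoc, ← Real.exp_add, ← Real.exp_add, neg_add_cancel, Real.exp_zero, mul_one] at this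
  refine this.trans_eq ?_
  congr 1
  ring

end Tail

/-! ### Coverings by Hamming balls. -/

section Covering

open scoped symmDiff

/-- Greedy covering: if every point is covered by a proportion at least `q` of the centres, then
`M` suitable centres leave at most a proportion `(1 - q) ^ M` of the points uncovered. -/
theorem exists_greedy_cover {α β : Type*} [DecidableEq β] (X : Finset α) (Y : Finset β)
    (r : α → β → Prop) [∀ x y, Decidable (r x y)] (q : ℝ) (hq : q ≤ 1)
    (hX : ∀ x ∈ X, q * Y.card ≤ ((Y.filter (r x)).card : ℝ)) (hY : Y.Nonempty) (M : ℕ) :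
    ∃ B : Finset β, B.card ≤ M ∧ ∃ U : Finset α, (U.card : ℝ) ≤ X.card * (1 - q) ^ M ∧ U ⊆ X ∧
      ∀ x ∈ X, x ∉ U → ∃ y ∈ B, r x y := by
  induction M with
  | zero => exact ⟨∅, by simp, X, by simp, subset_rfl, fun x hx hx' => absurd hx hx'⟩
  | succ M ih =>
    obtain ⟨B, hB, U, hle, hUX, hcov⟩ := ih
    -- Double counting: if each centre covered less than a proportion q of U, some point of U would
    -- be covered by fewer than q|Y| centres.
    have hex : ∃ y ∈ Y, q * U.card ≤ ((U.filter fun x => r x y).card : ℝ) := by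
      by_contra! hlt
      have h1 := Finset.sum_lt_sum_of_nonempty hY hlt
      have h2 : ∑ y ∈ Y, ((U.filter fun x => r x y).card : ℝ) =
          ∑ x ∈ U, ((Y.filter (r x)).card : ℝ) := by
        exact_mod_cast (Finset.sum_card_bipartiteAbove_eq_sum_card_bipartiteBelow (s := U) (t := Y)
          r).symm
      have h3 : ∑ x ∈ U, q * (Y.card : ℝ) ≤ ∑ x ∈ U, ((Y.filter (r x)).card : ℝ) :=
        Finset.sum_le_sum fun x hx => hX x (hUX hx)
      rw [Finset.sum_const, nsmul_eq_mul] at h1 h3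
      rw [h2] at h1
      nlinarith
    obtain ⟨y, -, hy⟩ := hex
    have hsplit : ((U.filter fun x => r x y).card : ℝ) + ((U.filter fun x => ¬ r x y).card : ℝ) =
        U.card := by
      exact_mod_cast Finset.card_filter_add_card_filter_not (s := U) fun x => r x y
    refine ⟨insert y B, (Finset.card_insert_le _ _).trans (by omega), U.filter fun x => ¬ r x y,
      ?_, (Finset.filter_subset _ _).trans hUX, fun x hx hx' => ?_⟩
    · rw [pow_succ]
      nlinarith [mul_le_mul_of_nonneg_right hle (sub_nonneg.2 hq)]
    · by_cases hxU : x ∈ U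
      · exact ⟨y, Finset.mem_insert_self _ _, by simpa [hxU] using hx'⟩
      · obtain ⟨z, hz, hxz⟩ := hcov x hx hxU
        exact ⟨z, Finset.mem_insert_of_mem hz, hxz⟩

/-- Joining an a-subset of A to a j-subset of its complement gives pairwise distinct centres C, each
missing k - a points of A and adding j outside it. -/
theorem choose_mul_choose_le_card_filter {n k a j : ℕ} (A : Finset (Fin n)) (hA : A.card = k) :
    k.choose a * (n - k).choose j ≤ ((Finset.univ.powersetCard (a + j)).filter
      fun C : Finset (Fin n) => (A ∆ C).card ≤ (k - a) + j).card := by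
  have hcard : (A.powersetCard a ×ˢ Aᶜ.powersetCard j).card = k.choose a * (n - k).choose j := by
    rw [Finset.card_product, Finset.card_powersetCard, Finset.card_powersetCard,
      Finset.card_compl, Fintype.card_fin, hA]
  rw [← hcard]
  refine Finset.card_le_card_of_injOn (fun P => P.1 ∪ P.2) ?_ ?_
  · rintro ⟨I, J⟩ hP
    simp only [Finset.coe_product, Set.mem_prod, Finset.mem_coe, Finset.mem_powersetCard] at hP
    obtain ⟨⟨hI, hIa⟩, hJ, hJj⟩ := hP
    have hdisj : Disjoint I J :=
      Finset.disjoint_of_subset_left hI (Finset.disjoint_of_subset_right hJ disjoint_compl_right)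
    have hsub : A ∆ (I ∪ J) ⊆ (A \ I) ∪ J := by
      intro x
      simp only [Finset.mem_symmDiff, Finset.mem_union, Finset.mem_sdiff]
      have := @hI x
      tauto
    simp only [Finset.coe_filter, Finset.mem_powersetCard, Set.mem_ofPred_eq, Finset.subset_univ,
      true_and]
    refine ⟨by rw [Finset.card_union_of_disjoint hdisj, hIa, hJj], (Finset.card_le_card hsub).trans
      ((Finset.card_union_le _ _).trans ?_)⟩
    rw [Finset.card_sdiff_of_subset hI, hA, hIa, hJj]
  · rintro ⟨I, J⟩ hP ⟨I', J'⟩ hP' heq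
    simp only [Finset.coe_product, Set.mem_prod, Finset.mem_coe, Finset.mem_powersetCard] at hP hP'
    simp only [Finset.ext_iff, Finset.mem_union] at heq
    obtain ⟨⟨hI, -⟩, hJ, -⟩ := hP
    obtain ⟨⟨hI', -⟩, hJ', -⟩ := hP'
    simp only [Prod.mk.injEq, Finset.ext_iff]
    simp only [Finset.subset_iff, Finset.mem_compl] at hI hJ hI' hJ'
    refine ⟨fun x => ?_, fun x => ?_⟩
    · have := heq x; have := @hI x; have := @hJ x; have := @hI' x; have := @hJ' x; tauto
    · have := heq x; have := @hI x; have := @hJ x; have := @hI' x; have := @hJ' x; tauto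

/-- Covering of the upper layers of the cube by Hamming balls whose radius grows with the layer. -/
theorem exists_cover_upper_layers {n k a j M : ℕ} (hn : 0 < n) (hak : a ≤ k) (hkn : k ≤ n)
    (hj : j ≤ n - k)
    (hM : (n : ℝ) * n.choose (a + j) ≤ M * (k.choose a * (n - k).choose j)) :
    ∃ B : Finset (Finset (Fin n)), B.card ≤ M ∧ ∀ A : Finset (Fin n), k ≤ A.card →
      ∃ C ∈ B, (A ∆ C).card + a ≤ A.card + j := by
  set q : ℝ := (k.choose a * (n - k).choose j : ℝ) / n.choose (a + j) with hq
  have hc : (0 : ℝ) < n.choose (a + j) := by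
    exact_mod_cast Nat.choose_pos (by omega)
  have hYcard : ((Finset.univ : Finset (Fin n)).powersetCard (a + j)).card = n.choose (a + j) := by
    simp
  have hnbr : ∀ A ∈ (Finset.univ : Finset (Fin n)).powersetCard k,
      q * (((Finset.univ : Finset (Fin n)).powersetCard (a + j)).card : ℝ) ≤
      (((Finset.univ.powersetCard (a + j)).filter
        fun C : Finset (Fin n) => (A ∆ C).card ≤ (k - a) + j).card : ℝ) := by
    intro A hA
    rw [hYcard, hq, div_mul_cancel₀ _ hc.ne']
    exact_mod_cast choose_mul_choose_le_card_filter A (Finset.mem_powersetCard.1 hA).2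
  have hX : ((Finset.univ : Finset (Fin n)).powersetCard k).Nonempty :=
    Finset.powersetCard_nonempty.2 (by simpa using hkn)
  have hY : ((Finset.univ : Finset (Fin n)).powersetCard (a + j)).Nonempty :=
    Finset.powersetCard_nonempty.2 (by simp; omega)
  have hq1 : q ≤ 1 := by
    obtain ⟨A, hA⟩ := hX
    have h1 := hnbr A hA
    have h2 : (((Finset.univ.powersetCard (a + j)).filter
        fun C : Finset (Fin n) => (A ∆ C).card ≤ (k - a) + j).card : ℝ) ≤
        (((Finset.univ : Finset (Fin n)).powersetCard (a + j)).card : ℝ) := by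
      exact_mod_cast Finset.card_filter_le _ _
    have h3 := h1.trans h2
    rw [hYcard] at h3
    exact le_of_mul_le_mul_right (by linarith) hc
  obtain ⟨B, hB, U, hle, -, hcov⟩ := exists_greedy_cover _ _ _ q hq1 hnbr hY M
  have hqM : (n : ℝ) ≤ M * q := by
    rw [hq, ← mul_div_assoc, le_div_iff₀ hc]
    exact hM
  -- Since Mq ≥ n, the greedy cover leaves at most 2ⁿe⁻ⁿ < 1 sets of the layer, hence none.
  have hlt : ((Finset.univ : Finset (Fin n)).powersetCard k).card * (1 - q) ^ M < (1 : ℝ) := by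
    have h1 : (1 - q) ^ M ≤ Real.exp (-n) := by
      calc (1 - q) ^ M ≤ (Real.exp (-q)) ^ M :=
            pow_le_pow_left₀ (by linarith) (Real.one_sub_le_exp_neg q) M
        _ = Real.exp (-(M * q)) := by rw [← Real.exp_nat_mul]; ring_nf
        _ ≤ _ := Real.exp_le_exp.2 (by linarith)
    have h2 : (((Finset.univ : Finset (Fin n)).powersetCard k).card : ℝ) ≤ 2 ^ n := by
      have := Finset.card_le_univ ((Finset.univ : Finset (Fin n)).powersetCard k)
      rw [Fintype.card_finset, Fintype.card_fin] at this
      exact_mod_cast this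
    have h3 : (2 : ℝ) ^ n < Real.exp n := by
      rw [← mul_one (n : ℝ), Real.exp_nat_mul]
      exact pow_lt_pow_left₀ (by linarith [Real.exp_one_gt_d9]) (by norm_num) hn.ne'
    calc _ ≤ (2 : ℝ) ^ n * Real.exp (-n) := mul_le_mul h2 h1 (pow_nonneg (by linarith) _)
          (by positivity)
      _ < Real.exp n * Real.exp (-n) := mul_lt_mul_of_pos_right h3 (Real.exp_pos _)
      _ = 1 := by rw [← Real.exp_add]; simp
  have hempty := hle.trans_lt hlt
  rw [Nat.cast_lt_one, Finset.card_eq_zero] at hempty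
  refine ⟨B, hB, fun A hA => ?_⟩
  -- A larger set is handled through any k-subset A': the centre of A' is farther from A by at most
  -- |A| - k, exactly what the radius gains.
  obtain ⟨A', hA', hcard⟩ := Finset.exists_subset_card_eq hA
  obtain ⟨C, hC, hCle⟩ := hcov A' (Finset.mem_powersetCard.2 ⟨Finset.subset_univ A', hcard⟩)
    (by simp [hempty])
  refine ⟨C, hC, ?_⟩
  have hsub : A ∆ C ⊆ (A \ A') ∪ (A' ∆ C) := by
    intro x
    simp only [Finset.mem_symmDiff, Finset.mem_union, Finset.mem_sdiff]
    have := @hA' x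
    tauto
  have h1 := (Finset.card_le_card hsub).trans (Finset.card_union_le _ _)
  rw [Finset.card_sdiff_of_subset hA', hcard] at h1
  omega

end Covering

/-! ### Finite-length bounds on the error probability. -/

section ErrorProbability

open scoped symmDiff

variable {𝔽 : Type*} [Fintype 𝔽] [DecidableEq 𝔽]

/-- Finiteness, with nonemptiness below, makes the infimum over codebooks an attained minimum. -/
instance (n : ℕ) (r : ℝ) : Finite (Codebook n r) := by
  unfold Codebook
  infer_instance

instance (n : ℕ) (r : ℝ) : Nonempty (Codebook n r) :=
  ⟨⟨∅, by simp; positivity⟩⟩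

theorem minErrorProb_le (p : ℝ) (φ : 𝔽 → 𝔽) {n : ℕ} (c : Fin n → 𝔽) {r d : ℝ}
    (B : Codebook n r) : minErrorProb p φ c r d ≤ errorProb p φ c (n * d) B.val :=
  ciInf_le (Set.finite_range _).bddBelow B

theorem exists_errorProb_eq_min (p : ℝ) (φ : 𝔽 → 𝔽) {n : ℕ} (c : Fin n → 𝔽) (r d : ℝ) :
    ∃ B : Codebook n r, errorProb p φ c (n * d) B.val = minErrorProb p φ c r d :=
  exists_eq_ciInf_of_finite

variable [Nontrivial 𝔽]

open Classical in
theorem errorProb_eq_sum_finset {p : ℝ} {φ : 𝔽 → 𝔽} (hφ : IsHardDecision p φ)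
    (hp : (1 - p) / ((Fintype.card 𝔽 : ℝ) - 1) < p) {n : ℕ} (c : Fin n → 𝔽) (T : ℝ)
    (B : Finset (Fin n → Fin 2)) :
    errorProb p φ c T B = ∑ A : Finset (Fin n) with
      ∀ y ∈ B, T < ((A ∆ supportEquiv n y).card : ℝ) + (n - A.card),
        p ^ A.card * (1 - p) ^ (n - A.card) := by
  rw [errorProb, Finset.sum_filter, Finset.sum_filter, ← (supportEquiv n).sum_comp]
  refine Finset.sum_congr rfl fun x _ => ?_
  simp only [distortion_eq, patternProb_eq_prod hφ hp, prod_letterProb]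

theorem errorProb_le_one {p : ℝ} {φ : 𝔽 → 𝔽} (hφ : IsHardDecision p φ)
    (hp : (1 - p) / ((Fintype.card 𝔽 : ℝ) - 1) < p) (hp1 : p < 1) {n : ℕ} (c : Fin n → 𝔽) (T : ℝ)
    (B : Finset (Fin n → Fin 2)) : errorProb p φ c T B ≤ 1 := by
  have hp0 := correct_prob_pos hp hp1
  have : 0 < 1 - p := by linarith
  rw [errorProb_eq_sum_finset hφ hp]
  refine (Finset.sum_le_sum_of_subset_of_nonneg (Finset.filter_subset _ _)
    fun A _ _ => by positivity).trans_eq ?_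
  rw [Fin.sum_pow_mul_eq_add_pow]
  simp

/-- With the centres of `exists_cover_upper_layers`, a set of size at least k has distortion at most
n + j - a ≤ nd. Failures therefore lie in the lower tail at nu. -/
theorem exists_errorProb_le {p : ℝ} {φ : 𝔽 → 𝔽} (hφ : IsHardDecision p φ)
    (hp : (1 - p) / ((Fintype.card 𝔽 : ℝ) - 1) < p) (hp1 : p < 1) {n : ℕ} (c : Fin n → 𝔽)
    {d u : ℝ} (hu0 : 0 < u) (hup : u ≤ p) {k a j M : ℕ} (hn : 0 < n) (hak : a ≤ k) (hkn : k ≤ n)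
    (hj : j ≤ n - k) (hM : (n : ℝ) * n.choose (a + j) ≤ M * (k.choose a * (n - k).choose j))
    (hku : k ≤ ⌈(n : ℝ) * u⌉₊) (hd : (n : ℝ) * (1 - d) ≤ a - j) :
    ∃ B : Finset (Fin n → Fin 2), B.card ≤ M ∧
      errorProb p φ c (n * d) B ≤ Real.exp (-(n * (DKL u p * Real.log 2))) := by
  have hp0 := correct_prob_pos hp hp1
  have hq : 0 < 1 - p := by linarith
  obtain ⟨B, hB, hcov⟩ := exists_cover_upper_layers hn hak hkn hj hM
  refine ⟨B.map (supportEquiv n).symm.toEmbedding, by rwa [Finset.card_map], ?_⟩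
  rw [errorProb_eq_sum_finset hφ hp]
  refine le_trans (Finset.sum_le_sum_of_subset_of_nonneg (fun A hA => ?_)
    fun A _ _ => by positivity) (sum_lower_tail_le n hu0 hup hp1)
  simp only [Finset.mem_filter, Finset.mem_univ, true_and, Finset.mem_map,
    Equiv.coe_toEmbedding, forall_exists_index, and_imp, forall_apply_eq_imp_iff₂,
    Equiv.apply_symm_apply] at hA ⊢
  by_contra! hlt
  have hkA : k ≤ A.card := hku.trans (Nat.ceil_le.2 hlt.le)
  obtain ⟨C, hC, hle⟩ := hcov A hkA
  have h1 := hA C hC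
  have h2 : ((A ∆ C).card : ℝ) + a ≤ A.card + j := by exact_mod_cast hle
  linarith

/-- A k-set decoded by y is at distance at most nd - n + k ≤ n(u + d - 1) from y. So each y accounts
for at most a ball of k-sets, and all remaining k-sets have the same probability. -/
theorem le_errorProb {p : ℝ} {φ : 𝔽 → 𝔽} (hφ : IsHardDecision p φ)
    (hp : (1 - p) / ((Fintype.card 𝔽 : ℝ) - 1) < p) (hp1 : p < 1) {n : ℕ} (c : Fin n → 𝔽)
    {d u : ℝ} {k : ℕ} (hku : (k : ℝ) ≤ n * u) (B : Finset (Fin n → Fin 2)) :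
    ((n.choose k : ℝ) - B.card * ((Finset.univ.filter fun A : Finset (Fin n) =>
      (A.card : ℝ) ≤ n * (u + d - 1)).card : ℝ)) * (p ^ k * (1 - p) ^ (n - k)) ≤
      errorProb p φ c (n * d) B := by
  classical
  have hp0 := correct_prob_pos hp hp1
  have hq : 0 < 1 - p := by linarith
  set V := Finset.univ.filter fun A : Finset (Fin n) => (A.card : ℝ) ≤ n * (u + d - 1)
  set G : Finset (Finset (Fin n)) := Finset.univ.filter fun A =>
    ∀ y ∈ B, n * d < ((A ∆ supportEquiv n y).card : ℝ) + (n - A.card)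
  set L := (Finset.univ : Finset (Fin n)).powersetCard k
  have hcover : L \ G ⊆ B.biUnion fun y => V.image fun E => E ∆ supportEquiv n y := by
    intro A hA
    simp only [L, G, Finset.mem_sdiff, Finset.mem_powersetCard, Finset.mem_filter,
      Finset.mem_univ, true_and, Finset.subset_univ] at hA
    obtain ⟨hAk, hA⟩ := hA
    push Not at hA
    obtain ⟨y, hy, hle⟩ := hA
    simp only [Finset.mem_biUnion, Finset.mem_image]
    refine ⟨y, hy, A ∆ supportEquiv n y, ?_, symmDiff_symmDiff_cancel_right _ _⟩
    simp only [V, Finset.mem_filter, Finset.mem_univ, true_and]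
    rw [hAk] at hle
    linarith
  have hcard : (L \ G).card ≤ B.card * V.card :=
    (Finset.card_le_card hcover).trans
      (Finset.card_biUnion_le_card_mul _ _ _ fun y _ => Finset.card_image_le)
  have hL : L.card = n.choose k := by simp [L]
  have hLG : (n.choose k : ℝ) ≤ (L ∩ G).card + B.card * V.card := by
    have := Finset.card_sdiff_add_card_inter L G
    have h2 : n.choose k ≤ (L ∩ G).card + B.card * V.card := by omega
    exact_mod_cast h2
  rw [errorProb_eq_sum_finset hφ hp]
  calc _ ≤ ((L ∩ G).card : ℝ) * (p ^ k * (1 - p) ^ (n - k)) :=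
        mul_le_mul_of_nonneg_right (by linarith) (by positivity)
    _ = ∑ A ∈ L ∩ G, p ^ A.card * (1 - p) ^ (n - A.card) := by
        rw [← nsmul_eq_mul, ← Finset.sum_const]
        refine Finset.sum_congr rfl fun A hA => ?_
        rw [(Finset.mem_powersetCard.1 (Finset.mem_inter.1 hA).1).2]
    _ ≤ _ := Finset.sum_le_sum_of_subset_of_nonneg Finset.inter_subset_right
        fun A _ _ => by positivity

end ErrorProbability

/-! ### Exponential growth of factorials and binomial coefficients. -/

section Stirling

theorem tendsto_log_natCast_div : Tendsto (fun n : ℕ => Real.log n / n) atTop (𝓝 0) :=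
  Real.isLittleO_log_id_atTop.tendsto_div_nhds_zero.comp (tendsto_natCast_atTop_atTop (R := ℝ))

theorem tendsto_natCast_div_self : Tendsto (fun n : ℕ => (n : ℝ) / n) atTop (𝓝 1) := by
  refine tendsto_const_nhds.congr' ?_
  filter_upwards [eventually_gt_atTop 0] with n hn
  rw [div_self (by exact_mod_cast hn.ne')]

/-- Stirling's sequence has a positive limit, so its logarithm is bounded in the limit; what remains
is half of log(2m), negligible against m. -/
theorem tendsto_log_factorial_error_div :
    Tendsto (fun m : ℕ => (Real.log m.factorial - m * Real.log m + m) / m) atTop (𝓝 0) := by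
  have h1 : Tendsto (fun m : ℕ => Real.log (Stirling.stirlingSeq m) / m) atTop (𝓝 0) := by
    have hpi : Real.sqrt Real.pi ≠ 0 := (Real.sqrt_pos.2 Real.pi_pos).ne'
    exact (Stirling.tendsto_stirlingSeq_sqrt_pi.log hpi).div_atTop tendsto_natCast_atTop_atTop
  have h3 : Tendsto (fun m : ℕ => 1 / 2 * Real.log 2 / (m : ℝ)) atTop (𝓝 0) :=
    tendsto_const_div_atTop_nhds_zero_nat _
  have h := (h1.add (tendsto_log_natCast_div.const_mul (1 / 2))).add h3
  simp only [mul_zero, add_zero] at h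
  refine h.congr' ?_
  filter_upwards [eventually_gt_atTop 0] with m hm
  have hm' : (m : ℝ) ≠ 0 := by exact_mod_cast hm.ne'
  rw [Stirling.log_stirlingSeq_formula, Real.log_mul two_ne_zero hm',
    Real.log_div hm' (Real.exp_ne_zero 1), Real.log_exp]
  field_simp
  ring

theorem tendsto_atTop_of_tendsto_div {m : ℕ → ℕ} {x : ℝ} (hx : 0 < x)
    (hm : Tendsto (fun n : ℕ => (m n : ℝ) / n) atTop (𝓝 x)) : Tendsto m atTop atTop := by
  have h := hm.pos_mul_atTop hx (tendsto_natCast_atTop_atTop (R := ℝ))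
  rw [← tendsto_natCast_atTop_iff (R := ℝ)]
  refine h.congr' ?_
  filter_upwards [eventually_gt_atTop 0] with n hn
  have hn' : (n : ℝ) ≠ 0 := by exact_mod_cast hn.ne'
  field_simp

/-- Centring at m log n, not m log m, makes the linear and the log n terms cancel between the three
factorials of a binomial coefficient. -/
theorem tendsto_log_factorial {m : ℕ → ℕ} {x : ℝ} (hx : 0 < x)
    (hm : Tendsto (fun n : ℕ => (m n : ℝ) / n) atTop (𝓝 x)) :
    Tendsto (fun n : ℕ => (Real.log (m n).factorial - m n * Real.log n + m n) / n) atTop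
      (𝓝 (x * Real.log x)) := by
  have hmt := tendsto_atTop_of_tendsto_div hx hm
  have h := ((tendsto_log_factorial_error_div.comp hmt).mul hm).add (hm.mul (hm.log hx.ne'))
  rw [zero_mul, zero_add] at h
  refine h.congr' ?_
  filter_upwards [eventually_gt_atTop 0, hmt.eventually_gt_atTop 0] with n hn hmn
  have hn' : (n : ℝ) ≠ 0 := by exact_mod_cast hn.ne'
  have hm' : (m n : ℝ) ≠ 0 := by exact_mod_cast hmn.ne'
  simp only [Function.comp]
  rw [Real.log_div hm' hn']
  field_simp
  ring

/-- Exponential growth rate of binomial coefficients. -/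
theorem tendsto_log_choose {a b : ℕ → ℕ} {x y : ℝ} (hy : 0 < y) (hyx : y < x)
    (ha : Tendsto (fun n : ℕ => (a n : ℝ) / n) atTop (𝓝 x))
    (hb : Tendsto (fun n : ℕ => (b n : ℝ) / n) atTop (𝓝 y)) :
    Tendsto (fun n : ℕ => Real.log ((a n).choose (b n)) / n) atTop
      (𝓝 (x * Real.log x - y * Real.log y - (x - y) * Real.log (x - y))) := by
  have hle : ∀ᶠ n in atTop, b n ≤ a n := by
    filter_upwards [hb.eventually_lt ha hyx, eventually_gt_atTop 0] with n hn hn0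
    rw [div_lt_div_iff_of_pos_right (by exact_mod_cast hn0)] at hn
    exact_mod_cast hn.le
  have hab : Tendsto (fun n : ℕ => ((a n - b n : ℕ) : ℝ) / n) atTop (𝓝 (x - y)) := by
    refine (ha.sub hb).congr' ?_
    filter_upwards [hle] with n hn
    rw [Nat.cast_sub hn, sub_div]
  refine (((tendsto_log_factorial (hy.trans hyx) ha).sub (tendsto_log_factorial hy hb)).sub
    (tendsto_log_factorial (sub_pos.2 hyx) hab)).congr' ?_
  filter_upwards [hle] with n hn
  rw [Nat.cast_choose ℝ hn, Real.log_div (by positivity) (by positivity),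
    Real.log_mul (by positivity) (by positivity), Nat.cast_sub hn]
  ring

theorem tendsto_log_choose_self {k : ℕ → ℕ} {u : ℝ} (hu0 : 0 < u) (hu1 : u < 1)
    (hk : Tendsto (fun n : ℕ => (k n : ℝ) / n) atTop (𝓝 u)) :
    Tendsto (fun n : ℕ => Real.log (n.choose (k n)) / n) atTop (𝓝 (Real.binEntropy u)) := by
  have h := tendsto_log_choose hu0 hu1 tendsto_natCast_div_self hk
  convert h using 2
  rw [Real.binEntropy, Real.log_inv, Real.log_inv, Real.log_one]
  ring

end Stirling

/-! ### Asymptotic exponents: achievability, converse and their conclusion. -/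

section Exponents

theorem binEntropy_eq (u : ℝ) :
    Real.binEntropy u = -(u * Real.log u) - (1 - u) * Real.log (1 - u) := by
  rw [Real.binEntropy, Real.log_inv, Real.log_inv]
  ring

/-- Chain rule for the mutual information of the optimal test channel. -/
theorem binEntropy_chain {t e : ℝ} (ht0 : 0 < t) (ht1 : t < 1) (he0 : 0 < e) (he1 : e < 1) {u : ℝ}
    (hu : u = t * (1 - e) + (1 - t) * e) :
    Real.binEntropy t -
      (u * Real.log u - t * (1 - e) * Real.log (t * (1 - e)) -
        (u - t * (1 - e)) * Real.log (u - t * (1 - e))) -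
      ((1 - u) * Real.log (1 - u) - t * e * Real.log (t * e) -
        (1 - u - t * e) * Real.log (1 - u - t * e)) =
      Real.binEntropy u - Real.binEntropy e := by
  have h1 : u - t * (1 - e) = (1 - t) * e := by rw [hu]; ring
  have h2 : 1 - u - t * e = (1 - t) * (1 - e) := by rw [hu]; ring
  have ht : (1 - t) ≠ 0 := by linarith
  have he : (1 - e) ≠ 0 := by linarith
  rw [h1, h2, Real.log_mul ht0.ne' he, Real.log_mul ht he0.ne', Real.log_mul ht0.ne' he0.ne',
    Real.log_mul ht he, binEntropy_eq, binEntropy_eq, binEntropy_eq]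
  ring

theorem tendsto_nat_ceil_mul_div {x : ℝ} (hx : 0 ≤ x) :
    Tendsto (fun n : ℕ => ((⌈(n : ℝ) * x⌉₊ : ℕ) : ℝ) / n) atTop (𝓝 x) := by
  have := (tendsto_nat_ceil_mul_div_atTop hx).comp (tendsto_natCast_atTop_atTop (R := ℝ))
  simpa [Function.comp_def, mul_comm] using this

theorem tendsto_nat_floor_mul_div {x : ℝ} (hx : 0 ≤ x) :
    Tendsto (fun n : ℕ => ((⌊(n : ℝ) * x⌋₊ : ℕ) : ℝ) / n) atTop (𝓝 x) := by
  have := (tendsto_nat_floor_mul_div_atTop hx).comp (tendsto_natCast_atTop_atTop (R := ℝ))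
  simpa [Function.comp_def, mul_comm] using this

theorem two_rpow_eq_exp (x : ℝ) : (2 : ℝ) ^ x = Real.exp (x * Real.log 2) := by
  rw [Real.rpow_def_of_pos two_pos, mul_comm]

variable {𝔽 : Type*} [Fintype 𝔽] [DecidableEq 𝔽]

/-- The exponential decay rate of the smallest error probability is the largest achievable
exponent. -/
theorem isGreatest_achievable_of_tendsto {p : ℝ} {φ : 𝔽 → 𝔽} {N : ℕ} (hN : 0 < N) {R D E : ℝ}
    (c : (n : ℕ) → Fin n → 𝔽)
    (hpos : ∀ᶠ n : ℕ in atTop, 0 < minErrorProb p φ (c n) (R / N) (D / N))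
    (hlim : Tendsto (fun n : ℕ => -(1 / (n : ℝ)) *
      Real.logb 2 (minErrorProb p φ (c n) (R / N) (D / N))) atTop (𝓝 E)) :
    IsGreatest {F : ℝ | IsAchievableExponent p φ c N R D F} (N * E) := by
  have hN' : (0 : ℝ) < N := by exact_mod_cast hN
  have hmul : ∀ n : ℕ, 0 < n → ∀ x : ℝ, -(1 / (n : ℝ)) * x * n = -x := by
    intro n hn x
    have : (n : ℝ) ≠ 0 := by exact_mod_cast hn.ne'
    field_simp
  constructor
  -- The minimisers at each length form one sequence of codebooks that serves every ε.
  · choose B hB using fun n => exists_errorProb_eq_min p φ (c n) (R / N) (D / N)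
    refine ⟨B, fun ε hε => ?_⟩
    filter_upwards [hpos, hlim.eventually_const_lt (sub_lt_self E hε), eventually_gt_atTop 0]
      with n hn hlt hn0
    have hn' : (0 : ℝ) < n := by exact_mod_cast hn0
    rw [hB, mul_div_cancel_left₀ _ hN'.ne', ← Real.logb_le_iff_le_rpow one_lt_two hn]
    have := mul_lt_mul_of_pos_right hlt hn'
    rw [hmul n hn0] at this
    linarith
  · rintro F ⟨B, hB⟩
    have hle : F / N ≤ E := by
      refine le_of_forall_pos_lt_add fun ε hε => ?_
      obtain ⟨n, h1, h2, h3, h4⟩ := ((hB (ε / 2) (by linarith)).and (hpos.and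
        ((hlim.eventually_lt_const (by linarith : E < E + ε / 2)).and
          (eventually_gt_atTop 0)))).exists
      have hn' : (0 : ℝ) < n := by exact_mod_cast h4
      have h5 := (Real.logb_le_iff_le_rpow one_lt_two h2).2
        ((minErrorProb_le p φ (c n) (B n)).trans h1)
      have h6 := mul_lt_mul_of_pos_right h3 hn'
      rw [hmul n h4] at h6
      have h7 : (n : ℝ) * (F / N - ε / 2) < n * (E + ε / 2) := by linarith
      linarith [lt_of_mul_lt_mul_left h7 hn'.le]
    rwa [div_le_iff₀' hN'] at hle

variable [Nontrivial 𝔽]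

/-- The strict inequality h(u) < r absorbs the factor n of the greedy cover and the rounding of
2^(nr) to an integer. -/
theorem eventually_minErrorProb_le {p : ℝ} {φ : 𝔽 → 𝔽} (hφ : IsHardDecision p φ)
    (hp : (1 - p) / ((Fintype.card 𝔽 : ℝ) - 1) < p) (hp1 : p < 1) {d r u : ℝ} (hd1 : d < 1)
    (hu0 : 1 - d < u) (hu1 : u < 1 - d / 2) (hup : u ≤ p) (hr : 0 < r) (hur : h d u < r) :
    ∀ᶠ n : ℕ in atTop, ∀ c : Fin n → 𝔽,
      minErrorProb p φ c r d ≤ Real.exp (-(n * (DKL u p * Real.log 2))) := by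
  have hl2 : 0 < Real.log 2 := Real.log_pos one_lt_two
  have hd0 : 0 < d := by linarith
  set e := u + d - 1 with he
  have he0 : 0 < e := by linarith
  have he1 : 0 < 1 - 2 * e := by linarith
  -- The weight fraction t of the centres makes u = t(1 - e) + (1 - t)e: a typical pattern is a
  -- centre passed through a binary symmetric channel with crossover probability e, the relative
  -- radius.
  set t := (1 - d) / (1 - 2 * e) with ht
  have ht0 : 0 < t := div_pos (by linarith) he1
  have ht1 : t < 1 := by rw [ht, div_lt_one he1]; linarith
  have htd : t * (1 - 2 * e) = 1 - d := div_mul_cancel₀ _ he1.ne'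
  have hu : u = t * (1 - e) + (1 - t) * e := by linarith
  have hte : 0 < t * e := mul_pos ht0 he0
  have hte' : 0 < (1 - t) * e := mul_pos (by linarith) he0
  have hte1 : 0 < t * (1 - e) := mul_pos ht0 (by linarith)
  have hte2 : 0 < (1 - t) * (1 - e) := mul_pos (by linarith) (by linarith)
  -- Rounding a up and j down gives a - j ≥ n(1 - d) exactly, and rounding k up puts every set of
  -- size above nu in a covered layer.
  set k : ℕ → ℕ := fun n => ⌈(n : ℝ) * u⌉₊
  set a : ℕ → ℕ := fun n => ⌈(n : ℝ) * (t * (1 - e))⌉₊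
  set j : ℕ → ℕ := fun n => ⌊(n : ℝ) * (t * e)⌋₊
  have hk : Tendsto (fun n : ℕ => (k n : ℝ) / n) atTop (𝓝 u) :=
    tendsto_nat_ceil_mul_div (by linarith)
  have ha : Tendsto (fun n : ℕ => (a n : ℝ) / n) atTop (𝓝 (t * (1 - e))) :=
    tendsto_nat_ceil_mul_div hte1.le
  have hj : Tendsto (fun n : ℕ => (j n : ℝ) / n) atTop (𝓝 (t * e)) :=
    tendsto_nat_floor_mul_div hte.le
  have haj : Tendsto (fun n : ℕ => ((a n + j n : ℕ) : ℝ) / n) atTop (𝓝 t) := by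
    have := ha.add hj
    rw [show t * (1 - e) + t * e = t by ring] at this
    refine this.congr fun n => ?_
    push_cast
    ring
  have hkn : ∀ n, k n ≤ n := fun n => Nat.ceil_le.2 (by nlinarith [Nat.cast_nonneg (α := ℝ) n])
  have hak : ∀ n, a n ≤ k n := fun n =>
    Nat.ceil_mono (mul_le_mul_of_nonneg_left (by linarith) (Nat.cast_nonneg n))
  have hnk : Tendsto (fun n : ℕ => ((n - k n : ℕ) : ℝ) / n) atTop (𝓝 (1 - u)) := by
    refine (tendsto_natCast_div_self.sub hk).congr fun n => ?_
    rw [Nat.cast_sub (hkn n), sub_div]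
  have hjn : ∀ᶠ n in atTop, j n ≤ n - k n := by
    filter_upwards [hj.eventually_lt hnk (by linarith), eventually_gt_atTop 0] with n hn hn0
    rw [div_lt_div_iff_of_pos_right (by exact_mod_cast hn0)] at hn
    exact_mod_cast hn.le
  -- The normalised logarithm of the number of centres required, including factors n and 2; the 2
  -- pays for the floor of 2^(nr).
  have hlim := ((((tendsto_const_div_atTop_nhds_zero_nat (Real.log 2)).add
    tendsto_log_natCast_div).add ((tendsto_log_choose_self ht0 ht1 haj).sub
    (tendsto_log_choose hte1 (by linarith) hk ha))).sub
    (tendsto_log_choose hte (by linarith) hnk hj))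
  have hval : (0 : ℝ) + 0 + (Real.binEntropy t -
      (u * Real.log u - t * (1 - e) * Real.log (t * (1 - e)) -
        (u - t * (1 - e)) * Real.log (u - t * (1 - e)))) -
      ((1 - u) * Real.log (1 - u) - t * e * Real.log (t * e) -
        (1 - u - t * e) * Real.log (1 - u - t * e)) < r * Real.log 2 := by
    rw [zero_add, zero_add, binEntropy_chain ht0 ht1 he0 (by linarith) hu, ← H_eq_binEntropy_mul,
      ← H_eq_binEntropy_mul, ← sub_mul]
    exact mul_lt_mul_of_pos_right hur hl2
  have hbig : ∀ᶠ n : ℕ in atTop, (2 : ℝ) ≤ 2 ^ ((n : ℝ) * r) := by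
    filter_upwards [tendsto_natCast_atTop_atTop.eventually_ge_atTop (1 / r)] with n hn
    have h1 : 1 ≤ (n : ℝ) * r := by rwa [div_le_iff₀ hr] at hn
    simpa using Real.rpow_le_rpow_of_exponent_le one_le_two h1
  filter_upwards [hlim.eventually_lt_const hval, hbig, hjn, eventually_gt_atTop 0]
    with n hn hbign hjn' hn0 c
  have hn0' : (0 : ℝ) < n := by exact_mod_cast hn0
  have hc1 : (0 : ℝ) < n.choose (a n + j n) := by
    exact_mod_cast Nat.choose_pos (by have := hkn n; have := hak n; omega)
  have hc2 : (0 : ℝ) < (k n).choose (a n) := by exact_mod_cast Nat.choose_pos (hak n)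
  have hc3 : (0 : ℝ) < (n - k n).choose (j n) := by exact_mod_cast Nat.choose_pos hjn'
  have hM2 : 2 * (n : ℝ) * n.choose (a n + j n) ≤
      2 ^ ((n : ℝ) * r) * ((k n).choose (a n) * (n - k n).choose (j n)) := by
    rw [← Real.log_le_log_iff (by positivity) (by positivity), Real.log_mul (by positivity)
      (by positivity), Real.log_mul (by positivity) (by positivity), Real.log_mul (by positivity)
      (by positivity), Real.log_mul (by positivity) (by positivity), Real.log_rpow two_pos]
    rw [← add_div, ← sub_div, ← add_div, ← sub_div, div_lt_iff₀ hn0'] at hn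
    linarith
  have hM : (n : ℝ) * n.choose (a n + j n) ≤
      (⌊(2 : ℝ) ^ ((n : ℝ) * r)⌋₊ : ℝ) * ((k n).choose (a n) * (n - k n).choose (j n)) := by
    have h1 : (2 : ℝ) ^ ((n : ℝ) * r) / 2 ≤ (⌊(2 : ℝ) ^ ((n : ℝ) * r)⌋₊ : ℝ) := by
      linarith [Nat.lt_floor_add_one ((2 : ℝ) ^ ((n : ℝ) * r))]
    have h2 := mul_le_mul_of_nonneg_right h1 (mul_pos hc2 hc3).le
    linarith
  have hdn : (n : ℝ) * (1 - d) ≤ a n - j n := by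
    have h1 : (n : ℝ) * (t * (1 - e)) ≤ a n := Nat.le_ceil _
    have h2 : (j n : ℝ) ≤ n * (t * e) := Nat.floor_le (by positivity)
    rw [← htd]
    linarith
  obtain ⟨B, hB, hle⟩ := exists_errorProb_le hφ hp hp1 c (by linarith : 0 < u) hup hn0 (hak n)
    (hkn n) hjn' hM le_rfl hdn
  have hB' : (B.card : ℝ) ≤ 2 ^ ((n : ℝ) * r) :=
    (Nat.cast_le.2 hB).trans (Nat.floor_le (by positivity))
  exact (minErrorProb_le p φ c ⟨B, hB'⟩).trans hle

/-- At least half of one layer near weight nu stays uncovered, and its total mass decays with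
exponent D_KL(u‖p); η absorbs the subexponential factors. -/
theorem eventually_le_minErrorProb {p : ℝ} {φ : 𝔽 → 𝔽} (hφ : IsHardDecision p φ)
    (hp : (1 - p) / ((Fintype.card 𝔽 : ℝ) - 1) < p) (hp1 : p < 1) {d r u : ℝ}
    (hu0 : 0 < u) (hu1 : u < 1) (hd : d < 1)
    (hu : u < 1 - d ∨ (1 - d < u ∧ u < 1 - d / 2 ∧ r < h d u)) {η : ℝ} (hη : 0 < η) :
    ∀ᶠ n : ℕ in atTop, ∀ c : Fin n → 𝔽,
      Real.exp (-(n * (DKL u p * Real.log 2 + η))) ≤ minErrorProb p φ c r d := by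
  have hl2 : 0 < Real.log 2 := Real.log_pos one_lt_two
  have hp0 := correct_prob_pos hp hp1
  have hq : 0 < 1 - p := by linarith
  set k : ℕ → ℕ := fun n => ⌊(n : ℝ) * u⌋₊
  have hk : Tendsto (fun n : ℕ => (k n : ℝ) / n) atTop (𝓝 u) := tendsto_nat_floor_mul_div hu0.le
  have hku : ∀ n, (k n : ℝ) ≤ n * u := fun n => Nat.floor_le (by positivity)
  have hkn : ∀ n, k n ≤ n := fun n => by
    have h1 : (k n : ℝ) ≤ n := (hku n).trans (by nlinarith [Nat.cast_nonneg (α := ℝ) n])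
    exact_mod_cast h1
  have hchoose := tendsto_log_choose_self hu0 hu1 hk
  have hlog2 := tendsto_const_div_atTop_nhds_zero_nat (Real.log 2)
  have hhalf : ∀ᶠ n : ℕ in atTop, ∀ B : Codebook n r, (B.val.card : ℝ) *
      ((Finset.univ.filter fun A : Finset (Fin n) => (A.card : ℝ) ≤ n * (u + d - 1)).card : ℝ) ≤
      n.choose (k n) / 2 := by
    -- Below 1 - d the radius is negative and the balls are empty, whatever the rate; otherwise the
    -- volume bound and r < h(u) apply.
    rcases hu with hu | ⟨hu2, hu3, hur⟩
    · filter_upwards [eventually_gt_atTop 0] with n hn B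
      have hn' : (0 : ℝ) < n := by exact_mod_cast hn
      have hempty : (Finset.univ.filter fun A : Finset (Fin n) =>
          (A.card : ℝ) ≤ n * (u + d - 1)) = ∅ := by
        refine Finset.filter_eq_empty_iff.2 fun A _ hA => ?_
        have : (0 : ℝ) ≤ A.card := Nat.cast_nonneg _
        nlinarith
      rw [hempty, Finset.card_empty, Nat.cast_zero, mul_zero]
      positivity
    · have hlt : (0 : ℝ) + (r * Real.log 2 + Real.binEntropy (u + d - 1)) < Real.binEntropy u := by
        have := mul_lt_mul_of_pos_right hur hl2
        rw [h, sub_mul, H_eq_binEntropy_mul, H_eq_binEntropy_mul] at this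
        linarith
      filter_upwards [(hlog2.add_const _).eventually_lt hchoose hlt, eventually_gt_atTop 0]
        with n hn hn0 B
      have hn' : (0 : ℝ) < n := by exact_mod_cast hn0
      have hc : (0 : ℝ) < n.choose (k n) := by exact_mod_cast Nat.choose_pos (hkn n)
      calc _ ≤ Real.exp (n * r * Real.log 2) * Real.exp (n * Real.binEntropy (u + d - 1)) := by
            refine mul_le_mul ?_ (card_filter_card_le_exp n (by linarith) (by linarith))
              (Nat.cast_nonneg _) (Real.exp_pos _).le
            rw [← two_rpow_eq_exp]
            exact B.2
        _ ≤ _ := by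
            rw [← Real.exp_add, ← Real.le_log_iff_exp_le (by positivity),
              Real.log_div hc.ne' two_ne_zero]
            rw [lt_div_iff₀ hn', add_mul, div_mul_cancel₀ _ hn'.ne'] at hn
            linarith
  have hlim := ((hchoose.sub hlog2).add (hk.mul_const (Real.log p))).add
    ((tendsto_natCast_div_self.sub hk).mul_const (Real.log (1 - p)))
  have hval : -(DKL u p * Real.log 2 + η) < Real.binEntropy u - 0 + u * Real.log p +
      (1 - u) * Real.log (1 - p) := by
    rw [DKL_mul_log hu0 hu1 hp0 hp1, binEntropy_eq]
    linarith
  filter_upwards [hhalf, hlim.eventually_const_lt hval, eventually_gt_atTop 0] with n hB hn hn0 c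
  have hn' : (0 : ℝ) < n := by exact_mod_cast hn0
  have hc : (0 : ℝ) < n.choose (k n) := by exact_mod_cast Nat.choose_pos (hkn n)
  refine le_ciInf fun B => le_trans ?_ (le_errorProb hφ hp hp1 c (hku n) B.val)
  have h1 : (n.choose (k n) : ℝ) / 2 ≤ (n.choose (k n) : ℝ) - B.val.card *
      ((Finset.univ.filter fun A : Finset (Fin n) => (A.card : ℝ) ≤ n * (u + d - 1)).card : ℝ) := by
    linarith [hB B]
  refine le_trans ?_ (mul_le_mul_of_nonneg_right h1 (by positivity))
  rw [← Real.le_log_iff_exp_le (by positivity), Real.log_mul (by positivity) (by positivity),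
    Real.log_div hc.ne' two_ne_zero, Real.log_mul (by positivity) (by positivity), Real.log_pow,
    Real.log_pow, Nat.cast_sub (hkn n)]
  have h2 := mul_lt_mul_of_pos_right hn hn'
  have h3 : (Real.log (n.choose (k n)) / n - Real.log 2 / n + k n / n * Real.log p +
      (n / n - k n / n) * Real.log (1 - p)) * n = Real.log (n.choose (k n)) - Real.log 2 +
      (k n * Real.log p + (n - k n) * Real.log (1 - p)) := by
    field_simp
    ring
  rw [h3] at h2
  linarith

/-- Any weight fraction below 1 - d works at every rate; (1 - d)/2 is one. Positivity avoids the
default value 0 of the logarithm at 0. -/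
theorem eventually_minErrorProb_pos {p : ℝ} {φ : 𝔽 → 𝔽} (hφ : IsHardDecision p φ)
    (hp : (1 - p) / ((Fintype.card 𝔽 : ℝ) - 1) < p) (hp1 : p < 1) {d r : ℝ} (hd0 : 0 < d)
    (hd1 : d < 1) (c : (n : ℕ) → Fin n → 𝔽) :
    ∀ᶠ n : ℕ in atTop, 0 < minErrorProb p φ (c n) r d := by
  filter_upwards [eventually_le_minErrorProb (r := r) hφ hp hp1
    (by linarith : 0 < (1 - d) / 2) (by linarith) hd1 (Or.inl (by linarith)) one_pos] with n hn
  exact (Real.exp_pos _).trans_le (hn (c n))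

/-- The exponent of the smallest error probability. -/
theorem tendsto_logb_minErrorProb {p : ℝ} {φ : 𝔽 → 𝔽} (hφ : IsHardDecision p φ)
    (hp : (1 - p) / ((Fintype.card 𝔽 : ℝ) - 1) < p) (hp1 : p < 1) {d r u : ℝ} (hd1 : d < 1)
    (hu : u ∈ Set.Ico (1 - d) (1 - d / 2)) (hur : h d u = r) (hr : 0 < r) (hup : u ≤ p)
    (c : (n : ℕ) → Fin n → 𝔽) :
    Tendsto (fun n : ℕ => -(1 / (n : ℝ)) * Real.logb 2 (minErrorProb p φ (c n) r d)) atTop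
      (𝓝 (DKL u p)) := by
  have hl2 : 0 < Real.log 2 := Real.log_pos one_lt_two
  have hp0 := correct_prob_pos hp hp1
  have hd0 : 0 < d := by linarith [hu.1, hu.2]
  have hu0 : 0 < u := by linarith [hu.1]
  have hu1 : u < 1 := by linarith
  have hanti := strictAntiOn_h hd1
  have huI : u ∈ Set.Icc (1 - d) (1 - d / 2) := ⟨hu.1, hu.2.le⟩
  have hcont := continuousAt_DKL hu0 hu1 hp0 hp1
  have hconv : ∀ b, DKL u p < b → ∃ v < b, ∀ᶠ n : ℕ in atTop,
      Real.exp (-(n * (v * Real.log 2))) ≤ minErrorProb p φ (c n) r d := by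
    intro b hb
    -- Just left of u the converse always applies: either u = 1 - d and v falls below 1 - d, or h(v)
    -- > h(u) = r by monotonicity.
    have hev : ∀ᶠ v in 𝓝[<] u, v < 1 - d ∨ (1 - d < v ∧ v < 1 - d / 2 ∧ r < h d v) := by
      rcases hu.1.eq_or_lt with heq | hlt
      · rw [← heq]
        filter_upwards [self_mem_nhdsWithin] with v hv using Or.inl hv
      · filter_upwards [self_mem_nhdsWithin, nhdsWithin_le_nhds (Ioi_mem_nhds hlt)] with v hv hv'
        have hvu : v < u := hv
        have hv1 : 1 - d < v := hv'
        refine Or.inr ⟨hv1, hvu.trans hu.2, ?_⟩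
        rw [← hur]
        exact hanti ⟨hv1.le, (hvu.trans hu.2).le⟩ huI hvu
    have hb' : ∀ᶠ v in 𝓝[<] u, DKL v p < b :=
      nhdsWithin_le_nhds (hcont.eventually_lt_const hb)
    have hpos : ∀ᶠ v in 𝓝[<] u, 0 < v := nhdsWithin_le_nhds (Ioi_mem_nhds hu0)
    obtain ⟨v, h1, h2, h3, h4⟩ := (hev.and (hb'.and (hpos.and self_mem_nhdsWithin))).exists
    have hvu : v < u := h4
    have hη : 0 < (b - DKL v p) / 2 * Real.log 2 := mul_pos (by linarith) hl2
    refine ⟨DKL v p + (b - DKL v p) / 2, by linarith, ?_⟩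
    filter_upwards [eventually_le_minErrorProb hφ hp hp1 h3 (hvu.trans hu1) hd1 h1 hη] with n hn
    rw [add_mul]
    exact hn (c n)
  have hpos := eventually_minErrorProb_pos hφ hp hp1 (r := r) hd0 hd1 c
  refine tendsto_order.2 ⟨fun b hb => ?_, fun b hb => ?_⟩
  -- When u = p there is no v in (u, p], but the exponent is 0 and a probability is at most 1.
  -- Otherwise the achievability bound is used at v slightly above u, where h(v) < r strictly.
  · rcases hup.eq_or_lt with rfl | hlt
    · have hzero : DKL u u = 0 := by
        have := DKL_mul_log hu0 hu1 hu0 hu1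
        simpa [hl2.ne'] using this
      filter_upwards [hpos] with n hn
      obtain ⟨B, hB⟩ := exists_errorProb_eq_min u φ (c n) r d
      have h1 : minErrorProb u φ (c n) r d ≤ 1 := hB ▸ errorProb_le_one hφ hp hp1 (c n) _ _
      have h2 : Real.logb 2 (minErrorProb u φ (c n) r d) ≤ 0 :=
        Real.logb_nonpos one_lt_two hn.le h1
      have h3 : (0 : ℝ) ≤ 1 / n := by positivity
      rw [hzero] at hb
      nlinarith
    · have hb' : ∀ᶠ v in 𝓝[>] u, b < DKL v p :=
        nhdsWithin_le_nhds (hcont.eventually_const_lt hb)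
      have hp' : ∀ᶠ v in 𝓝[>] u, v < p := nhdsWithin_le_nhds (Iio_mem_nhds hlt)
      have hd' : ∀ᶠ v in 𝓝[>] u, v < 1 - d / 2 := nhdsWithin_le_nhds (Iio_mem_nhds hu.2)
      obtain ⟨v, h1, h2, h3, h4⟩ := (hb'.and (hp'.and (hd'.and self_mem_nhdsWithin))).exists
      have huv : u < v := h4
      have hvr : h d v < r := by
        rw [← hur]
        exact hanti huI ⟨hu.1.trans huv.le, h3.le⟩ huv
      filter_upwards [hpos, eventually_gt_atTop 0, eventually_minErrorProb_le hφ hp hp1 hd1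
        (hu.1.trans_lt huv) h3 h2.le hr hvr] with n hn hn0 hle
      have hn' : (0 : ℝ) < n := by exact_mod_cast hn0
      have h5 := (Real.log_le_iff_le_exp hn).2 (hle (c n))
      refine h1.trans_le ?_
      rw [Real.logb, neg_mul, one_div_mul_eq_div, ← neg_div, ← neg_div, div_div,
        le_div_iff₀ (by positivity)]
      linarith
  · obtain ⟨v, hvb, hv⟩ := hconv b hb
    filter_upwards [hpos, eventually_gt_atTop 0, hv] with n hn hn0 hle
    have hn' : (0 : ℝ) < n := by exact_mod_cast hn0
    have h5 := (Real.le_log_iff_exp_le hn).2 hle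
    refine lt_of_le_of_lt ?_ hvb
    rw [Real.logb, neg_mul, one_div_mul_eq_div, ← neg_div, ← neg_div, div_div,
      div_le_iff₀ (by positivity)]
    linarith

end Exponents

end MultipleDecoding

end

theorem theorem5 {𝔽 : Type*} [Fintype 𝔽] [DecidableEq 𝔽] [Nontrivial 𝔽]
    (p : ℝ) (hp : (1 - p) / ((Fintype.card 𝔽 : ℝ) - 1) < p) (hp1 : p < 1)
    (φ : 𝔽 → 𝔽) (hφ : MultipleDecoding.IsHardDecision p φ)
    (c : (n : ℕ) → Fin n → 𝔽)
    (N : ℕ) (hN : 0 < N) (D : ℝ) (hD : D ∈ Set.Ioo (0 : ℝ) N)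
    (R : ℝ) (hR : R ∈ Set.Ioc (0 : ℝ) (N * MultipleDecoding.H (1 - D / N))) :
    (∀ (n : ℕ) (w : Fin n → 𝔽) (x : Fin n → Fin 2),
      MultipleDecoding.patternProb p φ w x = ∏ i, if x i = 1 then p else 1 - p) ∧
    Set.BijOn (MultipleDecoding.h (D / N)) (Set.Ico (1 - D / N) (1 - D / N / 2))
      (Set.Ioc 0 (MultipleDecoding.H (1 - D / N))) ∧
    (MultipleDecoding.hInv (D / N) (R / N) ≤ p →
      IsGreatest {F : ℝ | MultipleDecoding.IsAchievableExponent p φ c N R D F}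
        (N * MultipleDecoding.DKL (MultipleDecoding.hInv (D / N) (R / N)) p) ∧
      Filter.Tendsto (fun n : ℕ => -(1 / (n : ℝ)) *
          Real.logb 2 (MultipleDecoding.minErrorProb p φ (c n) (R / N) (D / N)))
        Filter.atTop
        (nhds (MultipleDecoding.DKL (MultipleDecoding.hInv (D / N) (R / N)) p))) := by
  have hN' : (0 : ℝ) < N := by exact_mod_cast hN
  have hd0 : 0 < D / N := div_pos hD.1 hN'
  have hd1 : D / N < 1 := (div_lt_one hN').2 hD.2
  have hr : R / N ∈ Set.Ioc 0 (MultipleDecoding.H (1 - D / N)) :=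
    ⟨div_pos hR.1 hN', (div_le_iff₀' hN').2 hR.2⟩
  have hbij := MultipleDecoding.bijOn_h hd0 hd1
  refine ⟨fun n w x => MultipleDecoding.patternProb_eq_prod hφ hp w x, hbij, fun hup => ?_⟩
  -- `Function.invFunOn` is a genuine preimage only where one exists; surjectivity of h supplies it.
  have himage : ∃ u ∈ Set.Ico (1 - D / N) (1 - D / N / 2),
      MultipleDecoding.h (D / N) u = R / N := hbij.surjOn hr
  have hlim := MultipleDecoding.tendsto_logb_minErrorProb hφ hp hp1 hd1
    (Function.invFunOn_mem himage) (Function.invFunOn_eq himage) hr.1 hup c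
  exact ⟨MultipleDecoding.isGreatest_achievable_of_tendsto hN c
    (MultipleDecoding.eventually_minErrorProb_pos hφ hp hp1 hd0 hd1 c) hlim, hlim⟩
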